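/- Let $G$ and $H$ be (real, finite-dimensional, smooth) Lie groups, with $G$ compact, and let $\operatorname{Hom}(G,H)$ be the space of continuous group homomorphisms $G\to H$ with the compact-open topology. For $h\in H$ and $\phi\in\operatorname{Hom}(G,H)$ let $h\phi h^{-1}$ denote the homomorphism $g\mapsto h\phi(g)h^{-1}$, and let $$C(\phi)=\{h\in H : \phi(g)h=h\phi(g)\ \text{for all } g\in G\}.$$ Let $R\subseteq \operatorname{Hom}(G,H)$ be any set containing exactly one element of every $H$-conjugacy class in $\operatorname{Hom}(G,H)$. Then the map $$\coprod_{\phi\in R} H/C(\phi)\longrightarrow \operatorname{Hom}(G,H),\qquad (\phi,hC(\phi))\longmapsto h\phi h^{-1},$$ is a homeomorphism, where each $H/C(\phi)$ carries the quotient topology and the coproduct the disjoint union topology. In particular, every $H$-conjugacy class is open in $\operatorname{Hom}(G,H)$, and $\operatorname{Hom}(G,H)$ is locally compact, and thus compactly generated and weak Hausdorff. -/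

import Mathlib

open scoped Manifold ContDiff

universe u

namespace HomSpace

section Conj

variable {G H : Type*} [Group G] [TopologicalSpace G] [Group H] [TopologicalSpace H]

/-- The conjugate `h φ h⁻¹ : g ↦ h * φ g * h⁻¹` of a continuous homomorphism `φ : G → H`. -/
def conj [ContinuousMul H] (h : H) (φ : G →ₜ* H) : G →ₜ* H where
  toFun g := h * φ g * h⁻¹
  map_one' := by simp
  map_mul' a b := by simp [mul_assoc]
  continuous_toFun :=
    (continuous_const.mul φ.continuous_toFun).mul continuous_const

@[simp] theorem conj_apply [ContinuousMul H] (h : H) (φ : G →ₜ* H) (g : G) :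
    conj h φ g = h * φ g * h⁻¹ := rfl

/-- The centralizer `C(φ) = {h ∈ H | φ(g) h = h φ(g) for all g ∈ G}`. -/
def cent (φ : G →ₜ* H) : Subgroup H := Subgroup.centralizer (Set.range φ)

theorem mem_cent {φ : G →ₜ* H} {h : H} : h ∈ cent φ ↔ ∀ g, φ g * h = h * φ g := by
  simp [cent, Subgroup.mem_centralizer_iff]

/-- The `H`-conjugacy class of `φ` in `Hom(G, H)`. -/
def conjClass [ContinuousMul H] (φ : G →ₜ* H) : Set (G →ₜ* H) :=
  Set.range fun h : H => conj h φ

/-- `R` contains exactly one element of every `H`-conjugacy class in `Hom(G, H)`. -/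
def IsConjTransversal [ContinuousMul H] (R : Set (G →ₜ* H)) : Prop :=
  ∀ ψ : G →ₜ* H, ∃! φ, φ ∈ R ∧ φ ∈ conjClass ψ

theorem conj_eq_of_inv_mul_mem [ContinuousMul H] (φ : G →ₜ* H) {a b : H}
    (hab : a⁻¹ * b ∈ cent φ) : conj a φ = conj b φ := by
  ext g
  have h := mem_cent.1 hab g
  have h2 : a * φ g * a⁻¹ * b = b * φ g := by
    calc a * φ g * a⁻¹ * b = a * (φ g * (a⁻¹ * b)) := by group
      _ = a * (a⁻¹ * b * φ g) := by rw [h]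
      _ = b * φ g := by group
  rw [conj_apply, conj_apply, ← h2, mul_inv_cancel_right]

/-- The map `H / C(φ) → Hom(G, H)`, `h C(φ) ↦ h φ h⁻¹`. -/
def orbitMap [ContinuousMul H] (φ : G →ₜ* H) (x : H ⧸ cent φ) : G →ₜ* H :=
  Quotient.liftOn' x (fun h => conj h φ) fun _ _ hab =>
    conj_eq_of_inv_mul_mem φ (QuotientGroup.leftRel_apply.1 hab)

theorem orbitMap_mk [ContinuousMul H] (φ : G →ₜ* H) (h : H) :
    orbitMap φ (h : H ⧸ cent φ) = conj h φ := rfl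

/-- The map `∐_{φ ∈ R} H / C(φ) → Hom(G, H)`, `(φ, h C(φ)) ↦ h φ h⁻¹`. -/
def coprodMap [ContinuousMul H] (R : Set (G →ₜ* H)) :
    (Σ φ : R, H ⧸ cent (φ : G →ₜ* H)) → (G →ₜ* H) :=
  fun p => orbitMap (p.1 : G →ₜ* H) p.2

end Conj

/-- Compactly generated weak Hausdorff (CGWH) spaces: a subset is closed as soon as its preimages
under all continuous maps from compact Hausdorff spaces are closed, and the image of every
continuous map from a compact Hausdorff space is closed. Test spaces in the universe of `X`
suffice: given `f : K → X`, the closure in `K` of a set of representatives of the nonempty fibres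
of `f` has the same image as `K` and cardinality at most `2 ^ 2 ^ #X`. -/
structure IsCGWH (X : Type u) [TopologicalSpace X] : Prop where
  compactlyGenerated : CompactlyGeneratedSpace X
  isClosed_range : ∀ (K : CompHaus.{u}) (f : C(K, X)), IsClosed (Set.range f)

end HomSpace

/-!
The heart of the matter is that a homomorphism `ψ` close to `φ` is conjugate to `φ` by an element
close to `1` (`HomSpace.eventually_exists_conj_eq`). Consider the action `g • h = ψ g * h * (φ g)⁻¹`
of `G` on `H`. Its fixed points are the `h` with `ψ = h φ h⁻¹`, so a fixed point near `1` is needed.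
The orbit of `1` stays near `1` because `ψ` is close to `φ`. In a chart at `1` with a Euclidean
norm, the action is uniformly `C²`: the pairs `(ψ g, φ g)` stay near the compact set of the
`(φ g, φ g)` (`HomSpace.exists_translationBound_nhdsSet`). On a small ball the invariant function
`x ↦ sup_g ‖g • x‖` is therefore strictly midpoint convex, the quadratic error being dominated by
the gain in the parallelogram law, and its unique minimizer is a fixed point
(`HomSpace.exists_forall_apply_eq_self`). This replaces averaging over an invariant measure.

It follows that the maps `h ↦ h φ h⁻¹` are open (`HomSpace.isOpenMap_conj_left`). Hence conjugacy
classes are open, the continuous bijection from the coproduct is open, and a compact neighbourhood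
of `1` in `H` yields one of `φ` in `Hom(G, H)`. As `Hom(G, H)` is Hausdorff, the remaining
properties follow.
-/

namespace HomSpace

open Metric Set Filter Topology

/-! ### Quadratic estimates and a local fixed point theorem -/

/-- Near a point where it is `C²`, a function is Lipschitz, and its value at a midpoint differs
from the average of its values by at most a multiple of the squared distance, because its
derivative is Lipschitz there. -/
theorem exists_norm_sub_midpoint_le {E F : Type*} [NormedAddCommGroup E] [NormedSpace ℝ E]
    [NormedAddCommGroup F] [NormedSpace ℝ F] {f : E → F} {c : E} (hf : ContDiffAt ℝ 2 f c) :
    ∃ K : ℝ, ∃ r > 0, ∀ z ∈ ball c r, ∀ w ∈ ball c r,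
      ‖f z - f w‖ ≤ K * ‖z - w‖ ∧
      ‖f (midpoint ℝ z w) - (2⁻¹ : ℝ) • (f z + f w)‖ ≤ K * ‖z - w‖ ^ 2 := by
  obtain ⟨K₁, t₁, ht₁, hl₁⟩ := (hf.of_le (by norm_num) : ContDiffAt ℝ 1 f c).exists_lipschitzOnWith
  obtain ⟨K₂, t₂, ht₂, hl₂⟩ :=
    (hf.fderiv_right (m := 1) (by norm_num)).exists_lipschitzOnWith
  have hd : ∀ᶠ z in 𝓝 c, DifferentiableAt ℝ f z :=
    (hf.eventually (by simp)).mono fun z hz => hz.differentiableAt (by simp)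
  obtain ⟨r, hr, hrs⟩ := Metric.mem_nhds_iff.1 (inter_mem (inter_mem ht₁ ht₂) hd)
  refine ⟨max K₁ K₂, r, hr, fun z hz w hw => ⟨?_, ?_⟩⟩
  · refine (hl₁.norm_sub_le (hrs hz).1.1 (hrs hw).1.1).trans ?_
    gcongr
    exact le_max_left _ _
  · have hseg : segment ℝ z w ⊆ ball c r := (convex_ball c r).segment_subset hz hw
    set m := midpoint ℝ z w with hm
    have hms : m ∈ segment ℝ z w := midpoint_mem_segment z w
    have ez : z - m = (2⁻¹ : ℝ) • (z - w) := by
      rw [hm, midpoint_eq_smul_add]; simp only [invOf_eq_inv]; module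
    have ew : w - m = -((2⁻¹ : ℝ) • (z - w)) := by
      rw [hm, midpoint_eq_smul_add]; simp only [invOf_eq_inv]; module
    have hnorm : ‖(2⁻¹ : ℝ) • (z - w)‖ = ‖z - w‖ / 2 := by
      rw [norm_smul, norm_inv, Real.norm_ofNat]; ring
    have hball : segment ℝ z w ⊆ closedBall m (‖z - w‖ / 2) :=
      (convex_closedBall _ _).segment_subset
        (by rw [mem_closedBall, dist_eq_norm, ez, hnorm])
        (by rw [mem_closedBall, dist_eq_norm, ew, norm_neg, hnorm])
    have key : ∀ y ∈ segment ℝ z w,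
        ‖f y - f m - fderiv ℝ f m (y - m)‖ ≤ K₂ * (‖z - w‖ / 2) * ‖y - m‖ := by
      intro y hy
      refine (convex_segment z w).norm_image_sub_le_of_norm_fderiv_le'
        (fun x hx => (hrs (hseg hx)).2) (fun x hx => ?_) hms hy
      refine (hl₂.norm_sub_le (hrs (hseg hx)).1.2 (hrs (hseg hms)).1.2).trans ?_
      gcongr
      exact mem_closedBall_iff_norm.1 (hball hx)
    have hz' := key z (left_mem_segment ℝ z w)
    have hw' := key w (right_mem_segment ℝ z w)
    rw [ez, hnorm] at hz'
    rw [ew, norm_neg, map_neg, hnorm] at hw'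
    set L := fderiv ℝ f m ((2⁻¹ : ℝ) • (z - w))
    have e : f m - (2⁻¹ : ℝ) • (f z + f w) =
        -((2⁻¹ : ℝ) • ((f z - f m - L) + (f w - f m - -L))) := by module
    have hK : (K₂ : ℝ) * ‖z - w‖ ^ 2 ≤ max (K₁ : ℝ) K₂ * ‖z - w‖ ^ 2 := by
      gcongr
      exact le_max_right _ _
    rw [e, norm_neg, norm_smul, norm_inv, Real.norm_ofNat]
    have := norm_add_le (f z - f m - L) (f w - f m - -L)
    have h0 : 0 ≤ (K₂ : ℝ) * ‖z - w‖ ^ 2 := by positivity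
    linarith

/-- A local form of the Bruhat–Tits fixed point theorem. Let a group act partially on the ball of
radius `s` in a Euclidean space by maps that are uniformly Lipschitz and affine up to a quadratic
error, and let `s` be small with respect to the constants. If the orbit of `0` stays in the ball,
then the action has a fixed point in it: the minimizer of `x ↦ sup_g ‖T g x‖`. This function is
invariant and, by the parallelogram law, strictly midpoint convex, so the minimizer is unique.
The hypothesis `hmul` asks for compatibility of `T` with multiplication only where no point
leaves the ball. -/
theorem exists_forall_apply_eq_self {V G : Type*} [NormedAddCommGroup V] [InnerProductSpace ℝ V]
    [FiniteDimensional ℝ V] [Group G] (T : G → V → V) {s K : ℝ} (hs : 0 ≤ s) (hK : 0 < K)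
    (hone : ∀ x, ‖x‖ ≤ s → T 1 x = x)
    (hmul : ∀ g h x, ‖x‖ ≤ s → ‖T h x‖ ≤ s → T (g * h) x = T g (T h x))
    (hlip : ∀ g x y, ‖x‖ ≤ s → ‖y‖ ≤ s → ‖T g x - T g y‖ ≤ K * ‖x - y‖)
    (hmid : ∀ g x y, ‖x‖ ≤ s → ‖y‖ ≤ s →
      ‖T g (midpoint ℝ x y) - (2⁻¹ : ℝ) • (T g x + T g y)‖ ≤ K * ‖x - y‖ ^ 2)
    (hzero : ∀ g, ‖T g 0‖ ≤ s)
    (hsmall : 4 * K ^ 2 * (2 * s * K + 4 * s ^ 2 * K ^ 2) < 1) :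
    ∃ x, ‖x‖ ≤ s ∧ ∀ g, T g x = x := by
  set F : V → ℝ := fun x => ⨆ g, ‖T g x‖ with hF
  have hbdd : ∀ x, ‖x‖ ≤ s → BddAbove (range fun g => ‖T g x‖) := by
    rintro x hx
    refine ⟨s + K * ‖x‖, ?_⟩
    rintro _ ⟨g, rfl⟩
    have h1 := hlip g x 0 hx (by simpa using hs)
    have h2 := norm_le_norm_add_norm_sub' (T g x) (T g 0)
    rw [sub_zero] at h1
    linarith [hzero g]
  have hle : ∀ x, ‖x‖ ≤ s → ∀ g, ‖T g x‖ ≤ F x := fun x hx g => le_ciSup (hbdd x hx) g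
  have hcont : ContinuousOn F (closedBall 0 s) := by
    refine (LipschitzOnWith.of_le_add_mul ⟨K, hK.le⟩ fun x hx y hy => ?_).continuousOn
    rw [mem_closedBall_zero_iff] at hx hy
    refine ciSup_le fun g => ?_
    rw [dist_eq_norm]
    have h1 := hlip g x y hx hy
    have h2 := norm_le_norm_add_norm_sub' (T g x) (T g y)
    have h3 := hle y hy g
    change _ ≤ _ + K * _
    linarith
  obtain ⟨x, hx, hmin⟩ := (isCompact_closedBall (0 : V) s).exists_isMinOn
    ⟨0, by simpa using hs⟩ hcont
  rw [mem_closedBall_zero_iff] at hx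
  -- Since `F 0 ≤ s`, the whole orbit of the minimizer stays in the ball.
  have hFs : F x ≤ s :=
    (hmin (show (0 : V) ∈ closedBall 0 s by simpa using hs)).trans (ciSup_le hzero)
  refine ⟨x, hx, fun h => ?_⟩
  have hy : ‖T h x‖ ≤ s := (hle x hx h).trans hFs
  set y := T h x with hyd
  have hFy : F y ≤ F x := ciSup_le fun g => by
    rw [← hmul g h x hx hy]; exact hle x hx _
  -- Both `x` and `y = T h x` minimize `F`; if they differ, `F` is smaller at their midpoint.
  by_contra hne
  have hD : 0 < ‖x - y‖ := norm_pos_iff.2 (sub_ne_zero.2 (Ne.symm hne))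
  have hDs : ‖x - y‖ ≤ 2 * s := (norm_sub_le x y).trans (by linarith)
  have hm : ‖midpoint ℝ x y‖ ≤ s := by
    have := (convex_closedBall (0 : V) s).midpoint_mem (x := x) (y := y)
      (by simpa using hx) (by simpa using hy)
    simpa using this
  set A := 2 * s * K + 4 * s ^ 2 * K ^ 2 with hA
  have hA0 : 0 ≤ A := by positivity
  set ε := ‖x - y‖ ^ 2 * (1 - 4 * K ^ 2 * A) / (4 * K ^ 2) with hε
  have hε0 : 0 < ε := by
    have : 0 < 1 - 4 * K ^ 2 * A := by linarith
    positivity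
  have hbound : ∀ g, ‖T g (midpoint ℝ x y)‖ ^ 2 ≤ F x ^ 2 - ε := by
    intro g
    have hgx : ‖T g x‖ ≤ F x := hle x hx g
    have hgy : ‖T g y‖ ≤ F x := (hle y hy g).trans hFy
    -- The inverse of `T g` is `T g⁻¹`, so the Lipschitz bound also holds in the other direction.
    have hinv : ‖x - y‖ ≤ K * ‖T g x - T g y‖ := by
      have h1 := hlip g⁻¹ _ _ (hgx.trans hFs) (hgy.trans hFs)
      rwa [← hmul _ _ _ hx (hgx.trans hFs), ← hmul _ _ _ hy (hgy.trans hFs), inv_mul_cancel,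
        hone x hx, hone y hy] at h1
    have hpar := parallelogram_law_with_norm ℝ (T g x) (T g y)
    have hav : ‖(2⁻¹ : ℝ) • (T g x + T g y)‖ = ‖T g x + T g y‖ / 2 := by
      rw [norm_smul]; norm_num; ring
    have h1 := hmid g x y hx hy
    have h2 := norm_le_norm_add_norm_sub' (T g (midpoint ℝ x y)) ((2⁻¹ : ℝ) • (T g x + T g y))
    rw [hav] at h2
    have h3 : ‖T g (midpoint ℝ x y)‖ ≤ ‖T g x + T g y‖ / 2 + K * ‖x - y‖ ^ 2 := by linarith
    have h4 : ‖T g x + T g y‖ / 2 ≤ s := by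
      have := norm_add_le (T g x) (T g y); linarith
    have h5 : ‖T g (midpoint ℝ x y)‖ ^ 2 ≤ (‖T g x + T g y‖ / 2) ^ 2 + A * ‖x - y‖ ^ 2 := by
      have e1 : ‖x - y‖ ^ 2 ≤ 4 * s ^ 2 := by nlinarith
      calc ‖T g (midpoint ℝ x y)‖ ^ 2 ≤ (‖T g x + T g y‖ / 2 + K * ‖x - y‖ ^ 2) ^ 2 := by gcongr
        _ = (‖T g x + T g y‖ / 2) ^ 2 + (2 * (‖T g x + T g y‖ / 2) * K
              + ‖x - y‖ ^ 2 * K ^ 2) * ‖x - y‖ ^ 2 := by ring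
        _ ≤ _ := by rw [hA]; gcongr
    have h6 : ‖x - y‖ ^ 2 / (4 * K ^ 2) ≤ ‖T g x - T g y‖ ^ 2 / 4 := by
      rw [div_le_div_iff₀ (by positivity) (by norm_num)]
      nlinarith [pow_le_pow_left₀ hD.le hinv 2]
    have h7 : ε = ‖x - y‖ ^ 2 / (4 * K ^ 2) - A * ‖x - y‖ ^ 2 := by
      rw [hε]; field_simp
    have hgx2 := pow_le_pow_left₀ (norm_nonneg _) hgx 2
    have hgy2 := pow_le_pow_left₀ (norm_nonneg _) hgy 2
    rw [h7]
    nlinarith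
  have h1 : F (midpoint ℝ x y) ≤ √(F x ^ 2 - ε) :=
    ciSup_le fun g => Real.le_sqrt_of_sq_le (hbound g)
  have hFx0 : 0 ≤ F x := (norm_nonneg _).trans (hle x hx 1)
  have h2 : √(F x ^ 2 - ε) < F x := by
    have h0 : 0 ≤ F x ^ 2 - ε := (sq_nonneg _).trans (hbound 1)
    have hpos : 0 < F x := lt_of_le_of_ne hFx0 fun h => by rw [← h] at h0; nlinarith
    rw [Real.sqrt_lt' hpos]; linarith
  have h3 : F x ≤ F (midpoint ℝ x y) := hmin (by simpa using hm)
  linarith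

/-! ### Translations of a Lie group in coordinates -/

/-- Smooth coordinates `k` at `p`, with inverse `j`, sending `p` to the origin of a given normed
space isomorphic to the model space. Both maps are total, with no meaning away from `p` and `0`. -/
theorem exists_smooth_coordinates {F M V : Type*} [NormedAddCommGroup F] [NormedSpace ℝ F]
    [TopologicalSpace M] [ChartedSpace F M] [IsManifold 𝓘(ℝ, F) ∞ M]
    [NormedAddCommGroup V] [NormedSpace ℝ V] (L : F ≃L[ℝ] V) (p : M) :
    ∃ (k : M → V) (j : V → M), k p = 0 ∧ j 0 = p ∧
      (∀ᶠ h in 𝓝 p, j (k h) = h) ∧ (∀ᶠ v in 𝓝 0, k (j v) = v) ∧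
      ContMDiffAt 𝓘(ℝ, F) 𝓘(ℝ, V) ∞ k p ∧ ContMDiffAt 𝓘(ℝ, V) 𝓘(ℝ, F) ∞ j 0 := by
  set χ := extChartAt 𝓘(ℝ, F) p with hχ
  have ht : χ.target ∈ 𝓝 (L.symm 0 + χ p) := by
    rw [map_zero, zero_add]
    exact extChartAt_target_mem_nhds p
  refine ⟨fun h => L (χ h - χ p), fun v => χ.symm (L.symm v + χ p), by simp, ?_, ?_, ?_, ?_, ?_⟩
  · simp [χ]
  · filter_upwards [extChartAt_source_mem_nhds (I := 𝓘(ℝ, F)) p] with h hh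
    simp only [sub_add_cancel, L.symm_apply_apply]
    exact χ.left_inv hh
  · have hL : ContinuousAt (fun v => L.symm v + χ p) 0 := by fun_prop
    filter_upwards [hL ht] with v hv
    rw [χ.right_inv hv, add_sub_cancel_right, L.apply_symm_apply]
  · have h1 : ContMDiff 𝓘(ℝ, F) 𝓘(ℝ, V) ∞ (fun v => L (v - χ p)) := by
      rw [contMDiff_iff_contDiff]; fun_prop
    exact h1.contMDiffAt.comp p contMDiffAt_extChartAt
  · have h1 : ContMDiff 𝓘(ℝ, V) 𝓘(ℝ, F) ∞ (fun v => L.symm v + χ p) := by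
      rw [contMDiff_iff_contDiff]; fun_prop
    exact ContMDiffAt.comp (I' := 𝓘(ℝ, F)) (g := χ.symm) 0
      ((contMDiffOn_extChartAt_symm p).contMDiffAt ht) h1.contMDiffAt

/-- In coordinates `k` with inverse `j` on the group `H`, the maps `h ↦ a * h * b⁻¹` with
`(a, b) ∈ N` send the ball of radius `r` into the domain of the coordinates, and there they are
`K`-Lipschitz and affine up to the quadratic error `K * ‖x - y‖ ^ 2` at midpoints. That a point lies
in the domain of the coordinates is expressed by `j ∘ k` fixing it. -/
def TranslationBound {H V : Type*} [Group H] [NormedAddCommGroup V] [NormedSpace ℝ V]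
    (k : H → V) (j : V → H) (N : Set (H × H)) (K r : ℝ) : Prop :=
  ∀ q ∈ N, ∀ x ∈ ball (0 : V) r,
    j (k (q.1 * j x * q.2⁻¹)) = q.1 * j x * q.2⁻¹ ∧
    ∀ y ∈ ball (0 : V) r,
      ‖k (q.1 * j x * q.2⁻¹) - k (q.1 * j y * q.2⁻¹)‖ ≤ K * ‖x - y‖ ∧
      ‖k (q.1 * j (midpoint ℝ x y) * q.2⁻¹) -
        (2⁻¹ : ℝ) • (k (q.1 * j x * q.2⁻¹) + k (q.1 * j y * q.2⁻¹))‖ ≤ K * ‖x - y‖ ^ 2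

theorem TranslationBound.mono {H V : Type*} [Group H] [NormedAddCommGroup V] [NormedSpace ℝ V]
    {k : H → V} {j : V → H} {N N' : Set (H × H)} {K K' r r' : ℝ}
    (h : TranslationBound k j N K r) (hN : N' ⊆ N) (hK : K ≤ K') (hr : r' ≤ r) :
    TranslationBound k j N' K' r' := fun q hq x hx =>
  ⟨(h q (hN hq) x (ball_subset_ball hr hx)).1, fun y hy => by
    obtain ⟨h1, h2⟩ := (h q (hN hq) x (ball_subset_ball hr hx)).2 y (ball_subset_ball hr hy)
    exact ⟨h1.trans (by gcongr), h2.trans (by gcongr)⟩⟩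

theorem TranslationBound.union {H V : Type*} [Group H] [NormedAddCommGroup V] [NormedSpace ℝ V]
    {k : H → V} {j : V → H} {N N' : Set (H × H)} {K r : ℝ}
    (h : TranslationBound k j N K r) (h' : TranslationBound k j N' K r) :
    TranslationBound k j (N ∪ N') K r := fun q hq => hq.elim (h q) (h' q)

section LieGroup

variable {F : Type*} [NormedAddCommGroup F] [NormedSpace ℝ F]
  {H : Type*} [Group H] [TopologicalSpace H] [ChartedSpace F H] [LieGroup 𝓘(ℝ, F) ∞ H]
  {V : Type*} [NormedAddCommGroup V] [NormedSpace ℝ V] {k : H → V} {j : V → H}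

/-- The coordinate expression of `(a, b, h) ↦ a * h * b⁻¹` is smooth near `(p, p, 1)`, so the
estimates hold uniformly for `(a, b)` near `(p, p)`. -/
theorem exists_translationBound_nhds (hj0 : j 0 = 1) (hjk : ∀ᶠ h in 𝓝 (1 : H), j (k h) = h)
    (hk : ContMDiffAt 𝓘(ℝ, F) 𝓘(ℝ, V) ∞ k 1) (hj : ContMDiffAt 𝓘(ℝ, V) 𝓘(ℝ, F) ∞ j 0) (p : H) :
    ∃ N ∈ 𝓝 (p, p), ∃ K : ℝ, ∃ r > 0, TranslationBound k j N K r := by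
  obtain ⟨kp, jp, hkp0, -, hjkp, -, hkp, hjp⟩ :=
    exists_smooth_coordinates (ContinuousLinearEquiv.refl ℝ F) p
  have hu : ContMDiffAt 𝓘(ℝ, F × F × V) 𝓘(ℝ, F) ∞ (fun z : F × F × V => jp z.1) 0 :=
    ContMDiffAt.comp (I' := 𝓘(ℝ, F)) (0 : F × F × V) hjp contDiff_fst.contMDiff.contMDiffAt
  have hv : ContMDiffAt 𝓘(ℝ, F × F × V) 𝓘(ℝ, F) ∞ (fun z : F × F × V => jp z.2.1) 0 :=
    ContMDiffAt.comp (I' := 𝓘(ℝ, F)) (0 : F × F × V) hjp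
      (contDiff_fst.comp contDiff_snd).contMDiff.contMDiffAt
  have hx : ContMDiffAt 𝓘(ℝ, F × F × V) 𝓘(ℝ, F) ∞ (fun z : F × F × V => j z.2.2) 0 :=
    ContMDiffAt.comp (I' := 𝓘(ℝ, V)) (0 : F × F × V) hj
      (contDiff_snd.comp contDiff_snd).contMDiff.contMDiffAt
  have hΨ : ContMDiffAt 𝓘(ℝ, F × F × V) 𝓘(ℝ, F) ∞
      (fun z : F × F × V => jp z.1 * j z.2.2 * (jp z.2.1)⁻¹) 0 := (hu.mul hx).mul hv.inv
  have hΨ0 : jp (0 : F × F × V).1 * j (0 : F × F × V).2.2 * (jp (0 : F × F × V).2.1)⁻¹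
      = 1 := by simp [hj0]
  have hΦ : ContMDiffAt 𝓘(ℝ, F × F × V) 𝓘(ℝ, V) ∞
      (fun z : F × F × V => k (jp z.1 * j z.2.2 * (jp z.2.1)⁻¹)) 0 :=
    ContMDiffAt.comp (I' := 𝓘(ℝ, F)) (g := k) (0 : F × F × V) (by rw [hΨ0]; exact hk) hΨ
  obtain ⟨K, r, hr, hest⟩ := exists_norm_sub_midpoint_le
    (hΦ.contDiffAt.of_le (m := 2) ENat.LEInfty.out)
  have hloc : ∀ᶠ z : F × F × V in 𝓝 0, j (k (jp z.1 * j z.2.2 * (jp z.2.1)⁻¹)) =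
      jp z.1 * j z.2.2 * (jp z.2.1)⁻¹ :=
    hΨ.continuousAt.eventually (p := fun h => j (k h) = h) (by simpa only [hΨ0] using hjk)
  obtain ⟨δ, hδ, hδloc⟩ := Metric.eventually_nhds_iff_ball.1 hloc
  set ρ := min r δ
  have hρ : 0 < ρ := lt_min hr hδ
  have hball : ∀ u ∈ ball (0 : F) ρ, ∀ v ∈ ball (0 : F) ρ, ∀ x ∈ ball (0 : V) ρ,
      ((u, v, x) : F × F × V) ∈ ball 0 r ∧ ((u, v, x) : F × F × V) ∈ ball 0 δ := by
    intro u hu v hv x hx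
    have : ((u, v, x) : F × F × V) ∈ ball 0 ρ := by
      simp only [mem_ball_zero_iff, Prod.norm_mk, sup_lt_iff] at *
      exact ⟨hu, hv, hx⟩
    exact ⟨ball_subset_ball (min_le_left _ _) this, ball_subset_ball (min_le_right _ _) this⟩
  have hU : {a : H | kp a ∈ ball 0 ρ ∧ jp (kp a) = a} ∈ 𝓝 p :=
    inter_mem (hkp.continuousAt (by rw [hkp0]; exact ball_mem_nhds _ hρ)) hjkp
  refine ⟨_, prod_mem_nhds hU hU, K, ρ, hρ, ?_⟩
  rintro ⟨a, b⟩ ⟨⟨ha, ha'⟩, hb, hb'⟩ x hx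
  have hzx := hball _ ha _ hb x hx
  refine ⟨by simpa [ha', hb'] using hδloc _ hzx.2, fun y hy => ?_⟩
  have hzy := hball _ ha _ hb y hy
  have hmain := hest _ hzx.1 _ hzy.1
  -- The parameters `a` and `b` are kept fixed, so only the last coordinate varies.
  have hmidp : midpoint ℝ ((kp a, kp b, x) : F × F × V) (kp a, kp b, y) =
      (kp a, kp b, midpoint ℝ x y) := by
    simp only [midpoint_eq_smul_add, Prod.mk_add_mk, Prod.smul_mk, ← two_smul ℝ (kp a),
      ← two_smul ℝ (kp b), invOf_smul_smul]
  have hnorm : ‖((kp a, kp b, x) : F × F × V) - (kp a, kp b, y)‖ = ‖x - y‖ := by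
    simp [Prod.norm_mk]
  rw [hmidp, hnorm] at hmain
  simpa only [ha', hb'] using hmain

theorem exists_translationBound_nhdsSet (hj0 : j 0 = 1)
    (hjk : ∀ᶠ h in 𝓝 (1 : H), j (k h) = h)
    (hk : ContMDiffAt 𝓘(ℝ, F) 𝓘(ℝ, V) ∞ k 1) (hj : ContMDiffAt 𝓘(ℝ, V) 𝓘(ℝ, F) ∞ j 0)
    {D : Set (H × H)} (hD : IsCompact D) (hdiag : ∀ q ∈ D, q.1 = q.2) :
    ∃ N ∈ 𝓝ˢ D, ∃ K : ℝ, ∃ r > 0, TranslationBound k j N K r := by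
  refine hD.induction_on (p := fun S => ∃ N ∈ 𝓝ˢ S, ∃ K : ℝ, ∃ r > 0, TranslationBound k j N K r)
    ?_ ?_ ?_ ?_
  · exact ⟨∅, by simp, 0, 1, one_pos, fun q hq => hq.elim⟩
  · rintro S S' hS ⟨N, hN, h⟩
    exact ⟨N, nhdsSet_mono hS hN, h⟩
  · rintro S S' ⟨N, hN, K, r, hr, h⟩ ⟨N', hN', K', r', hr', h'⟩
    refine ⟨N ∪ N', union_mem_nhdsSet hN hN', max K K', min r r', lt_min hr hr', ?_⟩
    exact (h.mono subset_rfl (le_max_left _ _) (min_le_left _ _)).union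
      (h'.mono subset_rfl (le_max_right _ _) (min_le_right _ _))
  · rintro ⟨p, p'⟩ hp
    obtain rfl : p = p' := hdiag _ hp
    obtain ⟨N, hN, h⟩ := exists_translationBound_nhds hj0 hjk hk hj p
    exact ⟨interior N, mem_nhdsWithin_of_mem_nhds (interior_mem_nhds.2 hN), N,
      mem_nhdsSet_interior, h⟩

/-! ### Nearby homomorphisms are conjugate -/

variable {G : Type*} [Group G] [TopologicalSpace G] [CompactSpace G]
  [IsTopologicalGroup H]

theorem eventually_forall_prod_mem (φ : G →ₜ* H) {O : Set (H × H)}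
    (hO : O ∈ 𝓝ˢ (range fun g => (φ g, φ g))) : ∀ᶠ ψ : G →ₜ* H in 𝓝 φ, ∀ g, (ψ g, φ g) ∈ O := by
  have hc : Continuous fun f : C(G, H) => f.prodMk (φ : C(G, H)) := by
    refine ContinuousMap.continuous_of_continuous_uncurry _ ?_
    change Continuous fun q : C(G, H) × G => (q.1 q.2, φ q.2)
    fun_prop
  have h1 : ∀ᶠ f : C(G, H × H) in 𝓝 ((φ : C(G, H)).prodMk (φ : C(G, H))),
      MapsTo f univ (interior O) :=
    ContinuousMap.eventually_mapsTo isCompact_univ isOpen_interior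
      fun g _ => subset_interior_iff_mem_nhdsSet.2 hO ⟨g, rfl⟩
  have h2 := (hc.comp
    (ContinuousMonoidHom.isInducing_toContinuousMap G H).continuous).continuousAt.eventually h1
  filter_upwards [h2] with ψ hψ g
  exact interior_subset (hψ (mem_univ g))

/-- Homomorphisms close to `φ` are conjugate to `φ` by elements close to `1`. For `ψ` close to `φ`,
the action `g • h = ψ g * h * (φ g)⁻¹` of `G` on `H` moves `1` only slightly, so it has a fixed
point near `1`, and `h` is a fixed point exactly when `ψ = h φ h⁻¹`. -/
theorem eventually_exists_conj_eq (F : Type*) [NormedAddCommGroup F] [NormedSpace ℝ F]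
    [FiniteDimensional ℝ F] [ChartedSpace F H] [LieGroup 𝓘(ℝ, F) ∞ H]
    (φ : G →ₜ* H) {W : Set H} (hW : W ∈ 𝓝 1) :
    ∀ᶠ ψ in 𝓝 φ, ∃ h ∈ W, conj h φ = ψ := by
  obtain ⟨k, j, hk0, hj0, hjk, hkj, hk, hj⟩ :=
    exists_smooth_coordinates (toEuclidean (E := F)) (1 : H)
  obtain ⟨N, hN, K₀, r, hr, hb₀⟩ := exists_translationBound_nhdsSet hj0 hjk hk hj
    (D := range fun g => (φ g, φ g)) (isCompact_range (by fun_prop)) (by rintro _ ⟨g, rfl⟩; rfl)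
  set K := max K₀ 1
  have hK : 0 < K := lt_max_of_lt_right one_pos
  have hb : TranslationBound k j N K r := hb₀.mono subset_rfl (le_max_left _ _) le_rfl
  obtain ⟨δ, hδ, hδ'⟩ := Metric.eventually_nhds_iff_ball.1
    ((hj.continuousAt.eventually (p := (· ∈ W)) (by rwa [hj0])).and hkj)
  have hev : ∀ᶠ s : ℝ in 𝓝 0, 4 * K ^ 2 * (2 * s * K + 4 * s ^ 2 * K ^ 2) < 1 := by
    have : ContinuousAt (fun s : ℝ => 4 * K ^ 2 * (2 * s * K + 4 * s ^ 2 * K ^ 2)) 0 := by fun_prop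
    exact this.eventually_lt continuousAt_const (by simp)
  obtain ⟨s, ⟨⟨hsmall, hsr⟩, hsδ⟩, hs⟩ := ((((hev.and (gt_mem_nhds hr)).and
    (gt_mem_nhds hδ)).filter_mono nhdsWithin_le_nhds).and self_mem_nhdsWithin :
      ∀ᶠ s in 𝓝[>] (0 : ℝ), _).exists
  have hO : N ∩ {q : H × H | ‖k (q.1 * q.2⁻¹)‖ ≤ s} ∈ 𝓝ˢ (range fun g => (φ g, φ g)) := by
    refine inter_mem hN (mem_nhdsSet_iff_forall.2 ?_)
    rintro _ ⟨g, rfl⟩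
    have hc : ContinuousAt (fun q : H × H => k (q.1 * q.2⁻¹)) (φ g, φ g) :=
      ContinuousAt.comp (g := k) (by simpa using hk.continuousAt) (by fun_prop)
    have := hc.norm.eventually_lt continuousAt_const (g := fun _ => s) (by simpa [hk0] using hs)
    exact this.mono fun q hq => hq.le
  filter_upwards [eventually_forall_prod_mem φ hO] with ψ hψ
  have hmem : ∀ {x : EuclideanSpace ℝ (Fin (Module.finrank ℝ F))}, ‖x‖ ≤ s → x ∈ ball 0 r :=
    fun hx => mem_ball_zero_iff.2 (hx.trans_lt hsr)
  have hδs : ∀ {x : EuclideanSpace ℝ (Fin (Module.finrank ℝ F))}, ‖x‖ ≤ s →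
      j x ∈ W ∧ k (j x) = x :=
    fun hx => hδ' _ (mem_ball_zero_iff.2 (hx.trans_lt hsδ))
  obtain ⟨x, hx, hfix⟩ := exists_forall_apply_eq_self
    (fun (g : G) x => k (ψ g * j x * (φ g)⁻¹)) hs.le hK
    (fun x hx => by simpa using (hδs hx).2)
    (fun g h x hx _ => by
      rw [(hb _ (hψ h).1 x (hmem hx)).1]
      simp [mul_assoc])
    (fun g x y hx hy => ((hb _ (hψ g).1 x (hmem hx)).2 y (hmem hy)).1)
    (fun g x y hx hy => ((hb _ (hψ g).1 x (hmem hx)).2 y (hmem hy)).2)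
    (fun g => by simpa [hj0] using (hψ g).2) hsmall
  refine ⟨j x, (hδs hx).1, ContinuousMonoidHom.ext fun g => ?_⟩
  have h1 := (hb _ (hψ g).1 x (hmem hx)).1
  rw [hfix g] at h1
  -- Applying `j` to the fixed point equation gives `j x = ψ g * j x * (φ g)⁻¹`.
  rw [conj_apply]
  nth_rewrite 1 [h1]
  group

end LieGroup

/-! ### The orbit maps of the conjugation action -/

section Conj

variable {G H : Type*} [Group G] [TopologicalSpace G] [Group H] [TopologicalSpace H]

theorem conj_mul [ContinuousMul H] (a b : H) (φ : G →ₜ* H) :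
    conj (a * b) φ = conj a (conj b φ) :=
  ContinuousMonoidHom.ext fun g => by simp [mul_assoc]

theorem conj_one [ContinuousMul H] (φ : G →ₜ* H) : conj 1 φ = φ :=
  ContinuousMonoidHom.ext fun g => by simp

theorem orbitMap_injective [ContinuousMul H] (φ : G →ₜ* H) :
    Function.Injective (orbitMap φ) := by
  intro x y
  induction x using QuotientGroup.induction_on with | _ a
  induction y using QuotientGroup.induction_on with | _ b
  intro hab
  rw [orbitMap_mk, orbitMap_mk] at hab
  refine QuotientGroup.eq.2 (mem_cent.2 fun g => ?_)
  have h : a * φ g * a⁻¹ = b * φ g * b⁻¹ := DFunLike.congr_fun hab g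
  calc φ g * (a⁻¹ * b) = a⁻¹ * (a * φ g * a⁻¹) * b := by group
    _ = a⁻¹ * b * φ g := by rw [h]; group

theorem range_orbitMap [ContinuousMul H] (φ : G →ₜ* H) : range (orbitMap φ) = conjClass φ :=
  (QuotientGroup.mk_surjective.range_comp (orbitMap φ)).symm

theorem mem_conjClass_symm [ContinuousMul H] {φ ψ : G →ₜ* H} (h : ψ ∈ conjClass φ) :
    φ ∈ conjClass ψ := by
  obtain ⟨a, rfl⟩ := h
  exact ⟨a⁻¹, by simp only [← conj_mul, inv_mul_cancel, conj_one]⟩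

theorem coprodMap_bijective [ContinuousMul H] {R : Set (G →ₜ* H)} (hR : IsConjTransversal R) :
    Function.Bijective (coprodMap R) := by
  constructor
  · rintro ⟨⟨φ, hφ⟩, x⟩ ⟨⟨φ', hφ'⟩, x'⟩ h
    change orbitMap φ x = orbitMap φ' x' at h
    have h1 : orbitMap φ x ∈ conjClass φ := range_orbitMap φ ▸ mem_range_self x
    have h2 : orbitMap φ x ∈ conjClass φ' := h ▸ range_orbitMap φ' ▸ mem_range_self x'
    obtain rfl : φ = φ' := (hR (orbitMap φ x)).unique ⟨hφ, mem_conjClass_symm h1⟩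
      ⟨hφ', mem_conjClass_symm h2⟩
    rw [orbitMap_injective φ h]
  · intro ψ
    obtain ⟨φ, ⟨hφ, hφψ⟩, -⟩ := hR ψ
    have h := mem_conjClass_symm hφψ
    rw [← range_orbitMap] at h
    obtain ⟨x, hx⟩ := h
    exact ⟨⟨⟨φ, hφ⟩, x⟩, hx⟩

variable [IsTopologicalGroup H]

theorem continuous_conj_left (φ : G →ₜ* H) : Continuous fun h : H => conj h φ := by
  refine ContinuousMonoidHom.continuous_of_continuous_uncurry _ ?_
  change Continuous fun q : H × G => q.1 * φ q.2 * q.1⁻¹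
  fun_prop

/-- If homomorphisms close to any `φ` are conjugate to it by elements close to `1`, then the orbit
maps of the conjugation action are open. -/
theorem isOpenMap_conj_left
    (hloc : ∀ (φ : G →ₜ* H), ∀ W ∈ 𝓝 (1 : H), ∀ᶠ ψ in 𝓝 φ, ∃ h ∈ W, conj h φ = ψ)
    (φ : G →ₜ* H) : IsOpenMap fun h : H => conj h φ := by
  refine IsOpenMap.of_nhds_le fun a => ?_
  intro S hS
  have hW : (fun b => b * a) ⁻¹' ((fun h : H => conj h φ) ⁻¹' S) ∈ 𝓝 (1 : H) :=
    (continuous_mul_const a).continuousAt (by simpa using hS)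
  filter_upwards [hloc (conj a φ) _ hW] with ψ hψ
  obtain ⟨b, hb, rfl⟩ := hψ
  rw [← conj_mul]
  exact hb

end Conj

end HomSpace

theorem proposition7p1
    {E : Type*} [NormedAddCommGroup E] [NormedSpace ℝ E] [FiniteDimensional ℝ E]
    {F : Type*} [NormedAddCommGroup F] [NormedSpace ℝ F] [FiniteDimensional ℝ F]
    {G : Type*} [Group G] [TopologicalSpace G] [T2Space G] [ChartedSpace E G]
    [LieGroup 𝓘(ℝ, E) ∞ G] [CompactSpace G]
    {H : Type*} [Group H] [TopologicalSpace H] [T2Space H] [IsTopologicalGroup H]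
    [ChartedSpace F H] [LieGroup 𝓘(ℝ, F) ∞ H] :
    (∀ R : Set (G →ₜ* H), HomSpace.IsConjTransversal R →
      IsHomeomorph (HomSpace.coprodMap R)) ∧
    (∀ φ : G →ₜ* H, IsOpen (HomSpace.conjClass φ)) ∧
    LocallyCompactSpace (G →ₜ* H) ∧
    HomSpace.IsCGWH (G →ₜ* H) := by
  have hopen : ∀ φ : G →ₜ* H, IsOpenMap fun h : H => HomSpace.conj h φ :=
    HomSpace.isOpenMap_conj_left fun φ W hW => HomSpace.eventually_exists_conj_eq F φ hW
  have hlc : LocallyCompactSpace (G →ₜ* H) := by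
    have : LocallyCompactSpace H := ChartedSpace.locallyCompactSpace F H
    have : WeaklyLocallyCompactSpace (G →ₜ* H) := ⟨fun φ => by
      obtain ⟨K, hK, hK1⟩ := exists_compact_mem_nhds (1 : H)
      refine ⟨_, hK.image (HomSpace.continuous_conj_left φ), ?_⟩
      simpa only [HomSpace.conj_one] using (hopen φ).image_mem_nhds hK1⟩
    infer_instance
  refine ⟨fun R hR => ⟨?_, ?_, HomSpace.coprodMap_bijective hR⟩,
    fun φ => (hopen φ).isOpen_range, hlc, inferInstance,
    fun K f => (isCompact_range f.continuous).isClosed⟩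
  · refine continuous_sigma fun φ => ?_
    exact isQuotientMap_quotient_mk'.continuous_iff.2
      (HomSpace.continuous_conj_left (φ : G →ₜ* H))
  · refine isOpenMap_sigma.2 fun φ U hU => ?_
    have := hopen φ _ (hU.preimage QuotientGroup.continuous_mk)
    rwa [show (fun h : H => HomSpace.conj h (φ : G →ₜ* H)) =
      HomSpace.orbitMap (φ : G →ₜ* H) ∘ QuotientGroup.mk from rfl, Set.image_comp,
      Set.image_preimage_eq _ QuotientGroup.mk_surjective] at this
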